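/- Let $E$ be a finite-dimensional real normed vector space, and let $\mu$ be a Radon measure on $E$, i.e. a Borel measure that is finite on compact sets. The following notions do not depend on the choice of the norm. We say that $\mu$ has subexponential divergence if $\int_E e^{-s\|x\|}\,d\mu(x)<\infty$ for some $s\in\mathbb R$; its exponent of growth $\tau(\mu)\in\mathbb R\cup\{-\infty\}$ is then the infimum of all such $s$. An open cone is an open set $\mathcal C\subset E$ with $t\,\mathcal C\subset\mathcal C$ for every $t>0$. The indicator of growth of $\mu$ is the function $\psi_\mu:E\to\mathbb R\cup\{-\infty\}$ with $\psi_\mu(0)=0$ and, for $x\ne 0$, $$\psi_\mu(x)=\|x\|\,\inf\{\tau(\mu|_{\mathcal C}) : \mathcal C \text{ is an open cone containing } x\}.$$ We say that $\mu$ has concave growth if there are $\alpha,\beta,\gamma>0$ such that $\mu(B(x+y,\alpha))\ge\gamma\,\mu(B(x,\beta))\,\mu(B(y,\beta))$ for all $x,y\in E$, where $B(x,r)$ is the closed ball of radius $r$ centred at $x$. Let $F$ be a linear subspace of $E$, let $\pi:E\to G=E/F$ be the quotient map, with $G$ carrying the quotient norm, and suppose that $\mu$ has subexponential divergence and that $\psi_\mu(x)=-\infty$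 for every $x\in F\setminus\{0\}$. Then the pushforward $\nu=\pi_*\mu$ is finite on compact sets, has subexponential divergence, and for every $y\in G$ $$\psi_\nu(y)=\sup\{\psi_\mu(x) : x\in E,\ \pi(x)=y\}.$$ If in addition $\mu$ has concave growth, then $\psi_\nu:G\to\mathbb R\cup\{-\infty\}$ is concave, the set $$\Omega_\nu=\{\varphi\in G^* : \varphi(y)\ge\psi_\nu(y)\ \text{for all } y\in G\}$$ is non-empty, closed and convex, and for every $\varphi\in G^*$, writing $\overset{\circ}{\Omega}_\nu$ for the interior of $\Omega_\nu$, $$\int_G e^{-\varphi(y)}\,d\nu(y)<\infty\ \Rightarrow\ \varphi\in\Omega_\nu,\qquad \varphi\in\overset{\circ}{\Omega}_\nu\ \Rightarrow\ \int_G e^{-\varphi(y)}\,d\nu(y)<\infty.$$ -/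

import Mathlib

open MeasureTheory Set Topology

noncomputable section

/-! Only semi-normedness is required below so that the definitions apply verbatim to a quotient
`E ⧸ F` with its quotient (semi)norm, which is a norm when `F` is finite-dimensional. -/

/-- The integral of `exp (-s ‖x‖)` against `μ`. -/
def expIntegral {E : Type*} [SeminormedAddCommGroup E] [MeasurableSpace E]
    (μ : Measure E) (s : ℝ) : ENNReal :=
  ∫⁻ x, ENNReal.ofReal (Real.exp (-(s * ‖x‖))) ∂μ

/-- Subexponential divergence: the integral of `exp (-s ‖x‖)` is finite for some real `s`. -/
def SubexpDivergence {E : Type*} [SeminormedAddCommGroup E] [MeasurableSpace E]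
    (μ : Measure E) : Prop :=
  ∃ s : ℝ, expIntegral μ s < ⊤

/-- The exponent of growth: the infimum, in the extended reals, of all real `s` such that the
integral of `exp (-s ‖x‖)` is finite. -/
def growthExponent {E : Type*} [SeminormedAddCommGroup E] [MeasurableSpace E]
    (μ : Measure E) : EReal :=
  sInf {t : EReal | ∃ s : ℝ, t = (s : EReal) ∧ expIntegral μ s < ⊤}

/-- Open cones: open sets that are stable under multiplication by positive scalars. -/
def IsOpenCone {E : Type*} [SeminormedAddCommGroup E] [NormedSpace ℝ E] (C : Set E) : Prop :=
  IsOpen C ∧ ∀ t : ℝ, 0 < t → ∀ x ∈ C, t • x ∈ C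

open Classical in
/-- The indicator of growth `ψ_μ`: it is `0` at `0`, and at `x ≠ 0` it is `‖x‖` times the infimum,
over the open cones `C` containing `x`, of the exponent of growth of the restriction of `μ`
to `C`. -/
def growthIndicator {E : Type*} [SeminormedAddCommGroup E] [NormedSpace ℝ E] [MeasurableSpace E]
    (μ : Measure E) (x : E) : EReal :=
  if x = 0 then 0
  else (‖x‖ : EReal) *
    sInf {t : EReal | ∃ C : Set E, IsOpenCone C ∧ x ∈ C ∧ t = growthExponent (μ.restrict C)}

/-- Concave growth of a measure. -/
def ConcaveGrowth {E : Type*} [SeminormedAddCommGroup E] [MeasurableSpace E]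
    (μ : Measure E) : Prop :=
  ∃ α β γ : ℝ, 0 < α ∧ 0 < β ∧ 0 < γ ∧ ∀ x y : E,
    ENNReal.ofReal γ * μ (Metric.closedBall x β) * μ (Metric.closedBall y β)
      ≤ μ (Metric.closedBall (x + y) α)

/-- Concave functions with values in `ℝ ∪ {-∞}`. -/
def IsConcaveEReal {E : Type*} [AddCommGroup E] [Module ℝ E] (ψ : E → EReal) : Prop :=
  (∀ x, ψ x ≠ ⊤) ∧
    ∀ x y : E, ∀ a b : ℝ, 0 < a → 0 < b → a + b = 1 →
      (a : EReal) * ψ x + (b : EReal) * ψ y ≤ ψ (a • x + b • y)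

/-- The set `Ω` of all the linear functionals that dominate `ψ`. -/
def dominatingFunctionals {E : Type*} [SeminormedAddCommGroup E] [NormedSpace ℝ E]
    (ψ : E → EReal) : Set (E →L[ℝ] ℝ) :=
  {φ | ∀ x, ψ x ≤ (φ x : EReal)}

/-- The Laplace integral of `μ`: the integral of `exp (-φ x)` against `μ`. -/
def laplaceIntegral {E : Type*} [SeminormedAddCommGroup E] [NormedSpace ℝ E] [MeasurableSpace E]
    (μ : Measure E) (φ : E →L[ℝ] ℝ) : ENNReal :=
  ∫⁻ x, ENNReal.ofReal (Real.exp (-φ x)) ∂μ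

end

/-! The link between integrals and indicators is a test by continuous positively homogeneous
functions θ. If `exp (-θ)` is integrable on an open cone, then ψ ≤ θ there (`growthIndicator_le`);
if ψ < θ away from 0, compactness of the sphere makes `exp (-θ)` integrable
(`lintegral_exp_neg_lt_top`). Taking θ linear gives both Laplace statements.

Integrals against ν are integrals against μ of functions pulled back by π. If c exceeds the supremum
of ψ_μ over the fibre of y, `exists_homogeneous_dominating` builds θ on G with θ(y) ≤ c and ψ_μ < θ
∘ π off 0, so ψ_ν(y) ≤ c. The hypothesis on F is what allows this near the kernel. The reverse
inequality holds because preimages of open cones are open cones.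

For concavity, real numbers a < ψ_μ(x) and b < ψ_μ(y) yield balls of mass about e^{ta} near tx and
e^{ub} near uy. Concave growth multiplies them into balls of mass about e^{T(a+b)} near T(x+y),
which forces ψ_μ(x+y) ≥ a + b. Superadditivity passes to suprema over fibres, and Hahn–Banach then
gives a dominating functional. -/

/-- Continuous functions that are homogeneous of degree one under positive dilations. -/
structure IsPosHomogeneous {E : Type*} [SeminormedAddCommGroup E] [NormedSpace ℝ E]
    (θ : E → ℝ) : Prop where
  continuous : Continuous θ
  map_smul : ∀ t : ℝ, 0 < t → ∀ x, θ (t • x) = t * θ x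

/-- The weight is bounded below by a positive constant on bounded sets, so Markov's inequality
applies. This serves for the pushforward, where local finiteness is not given. -/
theorem SubexpDivergence.isFiniteMeasureOnCompacts {E : Type*} [NormedAddCommGroup E]
    [MeasurableSpace E] [OpensMeasurableSpace E] {μ : Measure E} (hμ : SubexpDivergence μ) :
    IsFiniteMeasureOnCompacts μ := by
  obtain ⟨s, hs⟩ := hμ
  refine ⟨fun K hK => ?_⟩
  obtain ⟨R, hR⟩ := hK.isBounded.exists_norm_le
  have hpos : (0 : ENNReal) < ENNReal.ofReal (Real.exp (-(|s| * R))) :=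
    ENNReal.ofReal_pos.2 (Real.exp_pos _)
  have hsub : K ⊆ {x | ENNReal.ofReal (Real.exp (-(|s| * R))) ≤
      ENNReal.ofReal (Real.exp (-(s * ‖x‖)))} := fun x hx => by
    refine ENNReal.ofReal_le_ofReal (Real.exp_le_exp.2 (neg_le_neg ?_))
    exact mul_le_mul (le_abs_self s) (hR x hx) (norm_nonneg _) (abs_nonneg _)
  refine (measure_mono hsub).trans_lt ((meas_ge_le_lintegral_div (by fun_prop) hpos.ne'
    ENNReal.ofReal_ne_top).trans_lt (ENNReal.div_lt_top hs.ne hpos.ne'))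

/-! ### Cones, homogeneous functions and the indicator of growth -/

section Basic

variable {E : Type*} [NormedAddCommGroup E] [NormedSpace ℝ E]

namespace IsPosHomogeneous

theorem map_zero {θ : E → ℝ} (h : IsPosHomogeneous θ) : θ 0 = 0 := by
  have := h.map_smul 2 two_pos 0
  rw [smul_zero] at this
  linarith

theorem norm : IsPosHomogeneous (fun x : E => ‖x‖) :=
  ⟨continuous_norm, fun t ht x => by simp [norm_smul, abs_of_pos ht]⟩

theorem add {θ η : E → ℝ} (h : IsPosHomogeneous θ) (h' : IsPosHomogeneous η) :
    IsPosHomogeneous (fun x => θ x + η x) :=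
  ⟨h.continuous.add h'.continuous, fun t ht x => by
    simp only [h.map_smul t ht, h'.map_smul t ht, mul_add]⟩

theorem const_mul {θ : E → ℝ} (h : IsPosHomogeneous θ) (c : ℝ) :
    IsPosHomogeneous (fun x => c * θ x) :=
  ⟨continuous_const.mul h.continuous, fun t ht x => by
    simp only [h.map_smul t ht]; ring⟩

theorem comp_clm {G : Type*} [NormedAddCommGroup G] [NormedSpace ℝ G] {θ : G → ℝ}
    (h : IsPosHomogeneous θ) (p : E →L[ℝ] G) : IsPosHomogeneous (fun x => θ (p x)) :=
  ⟨h.continuous.comp p.continuous, fun t ht x => by simp only [_root_.map_smul, h.map_smul t ht]⟩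

theorem of_clm (φ : E →L[ℝ] ℝ) : IsPosHomogeneous (fun x => φ x) :=
  ⟨φ.continuous, fun t _ x => by simp⟩

end IsPosHomogeneous

theorem isOpenCone_univ : IsOpenCone (univ : Set E) := ⟨isOpen_univ, fun _ _ _ _ => mem_univ _⟩

theorem isOpenCone_setOf_lt {θ η : E → ℝ} (h : IsPosHomogeneous θ) (h' : IsPosHomogeneous η) :
    IsOpenCone {x | θ x < η x} :=
  ⟨isOpen_lt h.continuous h'.continuous, fun t ht x hx => by
    simp only [mem_ofPred_eq, h.map_smul t ht, h'.map_smul t ht] at hx ⊢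
    exact mul_lt_mul_of_pos_left hx ht⟩

theorem IsOpenCone.inter {C D : Set E} (hC : IsOpenCone C) (hD : IsOpenCone D) :
    IsOpenCone (C ∩ D) :=
  ⟨hC.1.inter hD.1, fun t ht x hx => ⟨hC.2 t ht x hx.1, hD.2 t ht x hx.2⟩⟩

theorem IsOpenCone.union {C D : Set E} (hC : IsOpenCone C) (hD : IsOpenCone D) :
    IsOpenCone (C ∪ D) :=
  ⟨hC.1.union hD.1, fun t ht x hx => hx.imp (hC.2 t ht x) (hD.2 t ht x)⟩

theorem IsOpenCone.smul_mem_iff {C : Set E} (hC : IsOpenCone C) {t : ℝ} (ht : 0 < t) {x : E} :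
    t • x ∈ C ↔ x ∈ C := by
  refine ⟨fun h => ?_, hC.2 t ht x⟩
  have := hC.2 t⁻¹ (inv_pos.2 ht) _ h
  rwa [inv_smul_smul₀ ht.ne'] at this

theorem EReal.coe_mul_lt_coe_iff {r c : ℝ} (hr : 0 < r) (I : EReal) :
    (r : EReal) * I < c ↔ I < ((c / r : ℝ) : EReal) := by
  induction I with
  | bot => simp [EReal.coe_mul_bot_of_pos hr, EReal.bot_lt_coe]
  | coe a =>
    rw [← EReal.coe_mul, EReal.coe_lt_coe_iff, EReal.coe_lt_coe_iff, lt_div_iff₀ hr, mul_comm]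
  | top => simp [EReal.coe_mul_top_of_pos hr]

variable [MeasurableSpace E]

@[simp] theorem growthIndicator_zero (μ : Measure E) : growthIndicator μ 0 = 0 := by
  simp [growthIndicator]

/-- Unfolds the two nested infima into one cone and one exponent; later arguments work with this
strict form. -/
theorem growthIndicator_lt_iff {μ : Measure E} {x : E} (hx : x ≠ 0) {c : ℝ} :
    growthIndicator μ x < c ↔ ∃ C : Set E, IsOpenCone C ∧ x ∈ C ∧
      ∃ s : ℝ, s * ‖x‖ < c ∧ expIntegral (μ.restrict C) s < ⊤ := by
  have hx' : 0 < ‖x‖ := norm_pos_iff.2 hx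
  rw [growthIndicator, if_neg hx, EReal.coe_mul_lt_coe_iff hx', sInf_lt_iff]
  constructor
  · rintro ⟨_, ⟨C, hC, hxC, rfl⟩, h⟩
    rw [growthExponent, sInf_lt_iff] at h
    obtain ⟨_, ⟨s, rfl, hs⟩, h⟩ := h
    exact ⟨C, hC, hxC, s, (lt_div_iff₀ hx').1 (EReal.coe_lt_coe_iff.1 h), hs⟩
  · rintro ⟨C, hC, hxC, s, hs, h⟩
    refine ⟨_, ⟨C, hC, hxC, rfl⟩, ?_⟩
    rw [growthExponent, sInf_lt_iff]
    exact ⟨_, ⟨s, rfl, h⟩, EReal.coe_lt_coe_iff.2 ((lt_div_iff₀ hx').2 hs)⟩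

theorem growthIndicator_smul (μ : Measure E) {t : ℝ} (ht : 0 < t) (x : E) :
    growthIndicator μ (t • x) = t * growthIndicator μ x := by
  by_cases hx : x = 0
  · simp [hx]
  have : ∀ C : Set E, (IsOpenCone C ∧ t • x ∈ C) ↔ (IsOpenCone C ∧ x ∈ C) :=
    fun C => and_congr_right fun hC => hC.smul_mem_iff ht
  rw [growthIndicator, growthIndicator, if_neg hx, if_neg (smul_ne_zero ht.ne' hx), ← mul_assoc,
    ← EReal.coe_mul, norm_smul, Real.norm_of_nonneg ht.le]
  simp only [← and_assoc, this]

theorem lt_of_growthIndicator_smul {μ : Measure E} {θ : E → ℝ} (hθ : IsPosHomogeneous θ)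
    {t : ℝ} (ht : 0 < t) {x : E} (h : growthIndicator μ x < θ x) :
    growthIndicator μ (t • x) < θ (t • x) := by
  rw [growthIndicator_smul μ ht, hθ.map_smul t ht, EReal.coe_mul_lt_coe_iff ht,
    mul_div_cancel_left₀ _ ht.ne']
  exact h

variable [OpensMeasurableSpace E]

/-- A homogeneous function with finite Laplace integral on an open cone dominates the indicator
of growth on that cone. -/
theorem growthIndicator_le {μ : Measure E} {θ : E → ℝ} (hθ : IsPosHomogeneous θ) {C : Set E}
    (hC : IsOpenCone C) (hfin : ∫⁻ z in C, ENNReal.ofReal (Real.exp (-θ z)) ∂μ < ⊤) {x : E}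
    (hx : x ∈ C) : growthIndicator μ x ≤ θ x := by
  by_cases h0 : x = 0
  · simp [h0, hθ.map_zero]
  have hx' : 0 < ‖x‖ := norm_pos_iff.2 h0
  refine EReal.le_of_forall_lt_iff_le.1 fun c hc => ?_
  have hc := EReal.coe_lt_coe_iff.1 hc
  obtain ⟨d, hd, hdc⟩ := exists_between hc
  -- Shrink to the cone where θ lies below the multiple of the norm equal to d at x; there `exp
  -- (-θ)` dominates the norm weight.
  have hD := isOpenCone_setOf_lt hθ (IsPosHomogeneous.norm.const_mul (E := E) (d / ‖x‖))
  refine le_of_lt ((growthIndicator_lt_iff h0).2 ⟨_, hC.inter hD, ⟨hx, ?_⟩, d / ‖x‖, ?_, ?_⟩)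
  · simpa [div_mul_cancel₀ _ hx'.ne'] using hd
  · rwa [div_mul_cancel₀ _ hx'.ne']
  · refine lt_of_le_of_lt ?_ hfin
    refine (setLIntegral_mono' (hC.1.inter hD.1).measurableSet fun z hz => ?_).trans
      (lintegral_mono_set (t := C) inter_subset_left)
    exact ENNReal.ofReal_le_ofReal (Real.exp_le_exp.2 (neg_le_neg (le_of_lt hz.2)))

theorem exists_isOpenCone_of_growthIndicator_lt {μ : Measure E} {θ : E → ℝ}
    (hθ : IsPosHomogeneous θ) {x : E} (h0 : x ≠ 0) (h : growthIndicator μ x < θ x) :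
    ∃ C : Set E, IsOpenCone C ∧ x ∈ C ∧ (∀ z ∈ C, z ≠ 0 → growthIndicator μ z < θ z) ∧
      ∫⁻ z in C, ENNReal.ofReal (Real.exp (-θ z)) ∂μ < ⊤ := by
  obtain ⟨C, hC, hxC, s, hs, hfin⟩ := (growthIndicator_lt_iff h0).1 h
  have hD := isOpenCone_setOf_lt (IsPosHomogeneous.norm.const_mul (E := E) s) hθ
  refine ⟨_, hC.inter hD, ⟨hxC, hs⟩, fun z hz hz0 => ?_, ?_⟩
  · exact (growthIndicator_lt_iff hz0).2 ⟨C, hC, hz.1, s, hz.2, hfin⟩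
  · refine lt_of_le_of_lt ?_ hfin
    refine (setLIntegral_mono' (hC.1.inter hD.1).measurableSet fun z hz => ?_).trans
      (lintegral_mono_set (t := C) inter_subset_left)
    exact ENNReal.ofReal_le_ofReal (Real.exp_le_exp.2 (neg_le_neg (le_of_lt hz.2)))

theorem SubexpDivergence.exists_growthIndicator_le {μ : Measure E} (hμ : SubexpDivergence μ) :
    ∃ M : ℝ, 0 ≤ M ∧ ∀ x, growthIndicator μ x ≤ ((M * ‖x‖ : ℝ) : EReal) := by
  obtain ⟨s, hs⟩ := hμ
  refine ⟨max s 0, le_max_right _ _, fun x => ?_⟩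
  refine growthIndicator_le (IsPosHomogeneous.norm.const_mul (max s 0)) isOpenCone_univ ?_
    (mem_univ x)
  refine lt_of_le_of_lt ?_ hs
  rw [Measure.restrict_univ]
  refine lintegral_mono fun z => ENNReal.ofReal_le_ofReal (Real.exp_le_exp.2 (neg_le_neg ?_))
  exact mul_le_mul_of_nonneg_right (le_max_left _ _) (norm_nonneg z)

theorem SubexpDivergence.growthIndicator_ne_top {μ : Measure E} (hμ : SubexpDivergence μ) (x : E) :
    growthIndicator μ x ≠ ⊤ := by
  obtain ⟨M, -, hM⟩ := hμ.exists_growthIndicator_le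
  exact ((hM x).trans_lt (EReal.coe_lt_top _)).ne

end Basic

/-! ### Compactness of the unit sphere -/

section Compactness

variable {E : Type*} [NormedAddCommGroup E] [NormedSpace ℝ E] [FiniteDimensional ℝ E]
  [MeasurableSpace E] [OpensMeasurableSpace E]

/-- A homogeneous function strictly above the indicator of growth has finite Laplace integral. -/
theorem lintegral_exp_neg_lt_top {μ : Measure E} [IsFiniteMeasureOnCompacts μ] {θ : E → ℝ}
    (hθ : IsPosHomogeneous θ) (h : ∀ x, x ≠ 0 → growthIndicator μ x < θ x) :
    ∫⁻ z, ENNReal.ofReal (Real.exp (-θ z)) ∂μ < ⊤ := by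
  have : ProperSpace E := FiniteDimensional.proper_real E
  obtain ⟨U, hU, hsub, hfin⟩ : ∃ U : Set E, IsOpenCone U ∧ Metric.sphere (0 : E) 1 ⊆ U ∧
      ∫⁻ z in U, ENNReal.ofReal (Real.exp (-θ z)) ∂μ < ⊤ := by
    refine (isCompact_sphere (0 : E) 1).induction_on (p := fun S => ∃ U : Set E, IsOpenCone U ∧
      S ⊆ U ∧ ∫⁻ z in U, ENNReal.ofReal (Real.exp (-θ z)) ∂μ < ⊤) ?_ ?_ ?_ ?_
    · exact ⟨∅, ⟨isOpen_empty, fun _ _ _ h => h⟩, Subset.rfl, by simp⟩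
    · rintro S T hST ⟨U, hU, hT, hfin⟩
      exact ⟨U, hU, hST.trans hT, hfin⟩
    · rintro S T ⟨U, hU, hS, hfin⟩ ⟨V, hV, hT, hfin'⟩
      exact ⟨U ∪ V, hU.union hV, union_subset_union hS hT,
        (lintegral_union_le _ _ _).trans_lt (ENNReal.add_lt_top.2 ⟨hfin, hfin'⟩)⟩
    · intro x hx
      have hx0 : x ≠ 0 := ne_zero_of_mem_unit_sphere ⟨x, hx⟩
      obtain ⟨C, hC, hxC, -, hfin⟩ := exists_isOpenCone_of_growthIndicator_lt hθ hx0 (h x hx0)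
      exact ⟨C, mem_nhdsWithin_of_mem_nhds (hC.1.mem_nhds hxC), C, hC, Subset.rfl, hfin⟩
  -- The cone U contains every nonzero vector; only the origin, of finite mass, may be missing.
  have huniv : (univ : Set E) = U ∪ {0} := by
    refine (eq_univ_of_forall fun x => ?_).symm
    by_cases hx : x = 0
    · exact Or.inr hx
    · refine Or.inl ((hU.smul_mem_iff (inv_pos.2 (norm_pos_iff.2 hx))).1 (hsub ?_))
      simp [norm_smul, hx]
  rw [← setLIntegral_univ, huniv]
  refine (lintegral_union_le _ _ _).trans_lt (ENNReal.add_lt_top.2 ⟨hfin, ?_⟩)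
  rw [lintegral_singleton]
  exact ENNReal.mul_lt_top ENNReal.ofReal_lt_top isCompact_singleton.measure_lt_top

/-- Penalisation: near a zero of g on the sphere the strict inequality already holds on a cone with
n = 0, and near any other point a large n beats the bound `M * ‖x‖`. Compactness makes n uniform. -/
theorem exists_growthIndicator_lt_add_mul {μ : Measure E} (hμ : SubexpDivergence μ)
    {θ g : E → ℝ} (hθ : IsPosHomogeneous θ) (hg : IsPosHomogeneous g) (hg0 : ∀ x, 0 ≤ g x)
    (h : ∀ x, x ≠ 0 → g x = 0 → growthIndicator μ x < θ x) :
    ∃ n : ℝ, ∀ x, x ≠ 0 → growthIndicator μ x < ((θ x + n * g x : ℝ) : EReal) := by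
  have : ProperSpace E := FiniteDimensional.proper_real E
  obtain ⟨M, -, hM⟩ := hμ.exists_growthIndicator_le
  have hmono : ∀ {n m : ℝ}, n ≤ m → ∀ x, ((θ x + n * g x : ℝ) : EReal) ≤ (θ x + m * g x : ℝ) :=
    fun hnm x => EReal.coe_le_coe_iff.2 (by gcongr; exact hg0 x)
  obtain ⟨n, hn⟩ : ∃ n : ℝ, ∀ x ∈ Metric.sphere (0 : E) 1,
      growthIndicator μ x < ((θ x + n * g x : ℝ) : EReal) := by
    refine (isCompact_sphere (0 : E) 1).induction_on (p := fun S => ∃ n : ℝ, ∀ x ∈ S,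
      growthIndicator μ x < ((θ x + n * g x : ℝ) : EReal)) ?_ ?_ ?_ ?_
    · exact ⟨0, by simp⟩
    · rintro S T hST ⟨n, hn⟩
      exact ⟨n, fun x hx => hn x (hST hx)⟩
    · rintro S T ⟨n, hn⟩ ⟨m, hm⟩
      refine ⟨max n m, fun x hx => hx.elim (fun hx => (hn x hx).trans_le ?_)
        (fun hx => (hm x hx).trans_le ?_)⟩
      · exact hmono (le_max_left n m) x
      · exact hmono (le_max_right n m) x
    · intro x hx
      have hx0 : x ≠ 0 := ne_zero_of_mem_unit_sphere ⟨x, hx⟩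
      rcases (hg0 x).eq_or_lt with hgx | hgx
      · obtain ⟨C, hC, hxC, hlt, -⟩ :=
          exists_isOpenCone_of_growthIndicator_lt hθ hx0 (h x hx0 hgx.symm)
        refine ⟨C ∩ Metric.sphere 0 1, Filter.inter_mem
          (mem_nhdsWithin_of_mem_nhds (hC.1.mem_nhds hxC)) self_mem_nhdsWithin, 0, fun z hz => ?_⟩
        simpa using hlt z hz.1 (ne_zero_of_mem_unit_sphere ⟨z, hz.2⟩)
      · set n := (M * ‖x‖ - θ x + 1) / g x with hn
        have hlt : M * ‖x‖ < θ x + n * g x := by rw [hn, div_mul_cancel₀ _ hgx.ne']; linarith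
        refine ⟨_, mem_nhdsWithin_of_mem_nhds ((isOpen_lt
          (continuous_const.mul continuous_norm)
          (hθ.add (hg.const_mul n)).continuous).mem_nhds hlt), n, fun z hz => ?_⟩
        exact (hM z).trans_lt (EReal.coe_lt_coe_iff.2 hz)
  refine ⟨n, fun x hx => ?_⟩
  have hx' : 0 < ‖x‖ := norm_pos_iff.2 hx
  have := lt_of_growthIndicator_smul (hθ.add (hg.const_mul n)) hx'
    (hn (‖x‖⁻¹ • x) (by simp [norm_smul, hx]))
  rwa [smul_inv_smul₀ hx'.ne'] at this

/-- If the indicator of growth is below `c` on the fibre of a linear map over `y` and is `-∞` on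
the kernel, it is dominated by the pullback of a homogeneous Lipschitz function that is at most
`c` at `y`. -/
theorem exists_homogeneous_dominating {G : Type*} [NormedAddCommGroup G] [NormedSpace ℝ G]
    {μ : Measure E} (hμ : SubexpDivergence μ) (p : E →L[ℝ] G)
    (hker : ∀ x, x ≠ 0 → p x = 0 → growthIndicator μ x = ⊥) {y : G} {c : ℝ} (hc : y = 0 → 0 ≤ c)
    (hfib : ∀ x, p x = y → growthIndicator μ x < c) :
    ∃ θ : G → ℝ, IsPosHomogeneous θ ∧ (∃ L : ℝ, 0 ≤ L ∧ ∀ u v, |θ u - θ v| ≤ L * ‖u - v‖) ∧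
      θ y ≤ c ∧ ∀ x, x ≠ 0 → growthIndicator μ x < θ (p x) := by
  by_cases hy : y = 0
  · obtain ⟨n, hn⟩ := exists_growthIndicator_lt_add_mul hμ
      (IsPosHomogeneous.norm.const_mul 0) (IsPosHomogeneous.norm.comp_clm p)
      (fun x => norm_nonneg _) (fun x hx hpx => by
        rw [hker x hx (norm_eq_zero.1 hpx)]; exact EReal.bot_lt_coe _)
    refine ⟨_, IsPosHomogeneous.norm.const_mul n, ⟨|n|, abs_nonneg n, fun u v => ?_⟩,
      by simpa [hy] using hc hy, fun x hx => by simpa using hn x hx⟩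
    rw [← mul_sub, abs_mul]
    exact mul_le_mul_of_nonneg_left (abs_norm_sub_norm_le u v) (abs_nonneg n)
  · have hy' : 0 < ‖y‖ := norm_pos_iff.2 hy
    -- This penalty vanishes exactly on the closed ray spanned by y, so only the fibre over y, up to
    -- scaling, and the kernel must be controlled beforehand.
    have hg : IsPosHomogeneous (fun z : G => ‖‖z‖ • y - ‖y‖ • z‖) :=
      ⟨by fun_prop, fun t ht z => by
        rw [norm_smul, Real.norm_of_nonneg ht.le, mul_smul, smul_comm _ t, ← smul_sub, norm_smul,
          Real.norm_of_nonneg ht.le]⟩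
    have hθ := IsPosHomogeneous.norm.const_mul (E := G) (c / ‖y‖)
    obtain ⟨n, hn⟩ := exists_growthIndicator_lt_add_mul hμ (hθ.comp_clm p) (hg.comp_clm p)
      (fun x => norm_nonneg _) (fun x hx hgx => by
        rw [norm_eq_zero, sub_eq_zero] at hgx
        by_cases hpx : p x = 0
        · rw [hker x hx hpx]; exact EReal.bot_lt_coe _
        have hpx' : 0 < ‖p x‖ := norm_pos_iff.2 hpx
        have hlt := hfib ((‖y‖ / ‖p x‖) • x) (by
          rw [map_smul, div_eq_inv_mul, mul_smul, ← hgx, inv_smul_smul₀ hpx'.ne'])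
        rw [growthIndicator_smul μ (div_pos hy' hpx'),
          EReal.coe_mul_lt_coe_iff (div_pos hy' hpx')] at hlt
        convert hlt using 2
        field_simp)
    refine ⟨_, hθ.add (hg.const_mul n),
      ⟨|c / ‖y‖| + |n| * (2 * ‖y‖), by positivity, fun u v => ?_⟩, ?_, hn⟩
    · have h1 : |‖‖u‖ • y - ‖y‖ • u‖ - ‖‖v‖ • y - ‖y‖ • v‖| ≤ 2 * ‖y‖ * ‖u - v‖ := by
        refine (abs_norm_sub_norm_le _ _).trans ?_
        have : ‖u‖ • y - ‖y‖ • u - (‖v‖ • y - ‖y‖ • v) = (‖u‖ - ‖v‖) • y - ‖y‖ • (u - v) := by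
          module
        rw [this]
        refine (norm_sub_le _ _).trans ?_
        rw [norm_smul, norm_smul, norm_norm, Real.norm_eq_abs]
        have := mul_le_mul_of_nonneg_right (abs_norm_sub_norm_le u v) hy'.le
        linarith
      have h2 := mul_le_mul_of_nonneg_left (abs_norm_sub_norm_le u v) (abs_nonneg (c / ‖y‖))
      have h3 := mul_le_mul_of_nonneg_left h1 (abs_nonneg n)
      rw [← abs_mul] at h2 h3
      calc _ = |c / ‖y‖ * (‖u‖ - ‖v‖) +
            n * (‖‖u‖ • y - ‖y‖ • u‖ - ‖‖v‖ • y - ‖y‖ • v‖)| := by congr 1; ring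
        _ ≤ _ := (abs_add_le _ _).trans (by linarith)
    · simp [div_mul_cancel₀ _ hy'.ne']

end Compactness

/-! ### Integrability from ball masses, and balls of large mass -/

section Haar

variable {E : Type*} [NormedAddCommGroup E] [NormedSpace ℝ E] [FiniteDimensional ℝ E]
  [MeasurableSpace E] [BorelSpace E]

/-- From t^n / n! ≤ e^t with n = dim E + 1, the exponential is bounded by a multiple of the
integrable function (1 + ‖x‖)^(-n). -/
theorem lintegral_exp_neg_mul_norm_lt_top (ν : Measure E) [ν.IsAddHaarMeasure] {η : ℝ}
    (hη : 0 < η) : ∫⁻ x, ENNReal.ofReal (Real.exp (-(η * ‖x‖))) ∂ν < ⊤ := by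
  set n := Module.finrank ℝ E + 1 with hn
  have hfin := finite_integral_one_add_norm (E := E) (μ := ν) (r := n) (by rw [hn]; norm_cast; simp)
  set K := Real.exp η * n.factorial / η ^ n with hK
  have hbound : ∀ x : E, Real.exp (-(η * ‖x‖)) ≤ K * (1 + ‖x‖) ^ (-(n : ℝ)) := fun x => by
    have h1 : 0 < 1 + ‖x‖ := by positivity
    have h := Real.pow_div_factorial_le_exp (x := η * (1 + ‖x‖)) (by positivity) n
    rw [div_le_iff₀ (by positivity), mul_pow, mul_add, mul_one, Real.exp_add] at h
    rw [Real.rpow_neg h1.le, Real.rpow_natCast, hK, Real.exp_neg, div_mul_eq_mul_div,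
      le_div_iff₀ (by positivity), inv_mul_le_iff₀ (Real.exp_pos _), ← div_eq_mul_inv,
      mul_div_assoc', le_div_iff₀ (by positivity)]
    linarith
  calc _ ≤ ∫⁻ x, ENNReal.ofReal K * ENNReal.ofReal ((1 + ‖x‖) ^ (-(n : ℝ))) ∂ν :=
        lintegral_mono fun x => by
          rw [← ENNReal.ofReal_mul (by positivity)]
          exact ENNReal.ofReal_le_ofReal (hbound x)
    _ = ENNReal.ofReal K * ∫⁻ x, ENNReal.ofReal ((1 + ‖x‖) ^ (-(n : ℝ))) ∂ν :=
        lintegral_const_mul' _ _ ENNReal.ofReal_ne_top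
    _ < ⊤ := ENNReal.mul_lt_top ENNReal.ofReal_lt_top hfin

/-- If the balls of radius `β` near `D` have mass at most `K * exp (b * ‖p‖)`, then
`exp (-s * ‖z‖)` is integrable on `D` for `b < s`. -/
theorem setLIntegral_exp_lt_top_of_closedBall_bound {μ : Measure E} [IsFiniteMeasureOnCompacts μ]
    {D : Set E} (hD : MeasurableSet D) {β b s K : ℝ} (hβ : 0 < β) (hbs : b < s) (hK : 0 ≤ K)
    (h : ∀ z ∈ D, ∀ p, dist z p ≤ β → μ.real (Metric.closedBall p β) ≤ K * Real.exp (b * ‖p‖)) :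
    ∫⁻ z in D, ENNReal.ofReal (Real.exp (-(s * ‖z‖))) ∂μ < ⊤ := by
  have : ProperSpace E := FiniteDimensional.proper_real E
  let ν : Measure E := Measure.addHaar
  set v := ν (Metric.closedBall 0 β) with hv
  have hv0 : v ≠ 0 := (Metric.measure_closedBall_pos ν 0 hβ).ne'
  have hvt : v ≠ ⊤ := (isCompact_closedBall (0 : E) β).measure_lt_top.ne
  let w : E → ENNReal := fun z => ENNReal.ofReal (Real.exp (-(s * ‖z‖)))
  have hw : Measurable w := by fun_prop
  -- Tonelli for this kernel: integrating in p gives w(z) times the Haar volume of a β-ball, while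
  -- integrating in z is controlled by the μ-mass of the β-ball around p.
  let k : E → E → ENNReal := fun z p => {q : E × E | dist q.1 q.2 ≤ β}.indicator (fun q => w q.1) (z, p)
  have hset : MeasurableSet {q : E × E | dist q.1 q.2 ≤ β} :=
    (isClosed_le continuous_dist continuous_const).measurableSet
  have hk : Measurable (Function.uncurry k) := (hw.comp measurable_fst).indicator hset
  have h1 : ∀ z, ∫⁻ p, k z p ∂ν = w z * v := fun z => by
    have : k z = (Metric.closedBall z β).indicator fun _ => w z := by
      ext p
      simp only [k, indicator, Metric.mem_closedBall, mem_ofPred_eq, dist_comm z p]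
    rw [this, lintegral_indicator_const Metric.isClosed_closedBall.measurableSet, hv,
      Measure.addHaar_closedBall_center]
  have h2 : ∀ p, ∫⁻ z in D, k z p ∂μ ≤
      ENNReal.ofReal (Real.exp (|s| * β) * K) * ENNReal.ofReal (Real.exp (-((s - b) * ‖p‖))) := by
    intro p
    by_cases hne : ∃ z ∈ D, dist z p ≤ β
    · obtain ⟨z₀, hz₀, hz₀p⟩ := hne
      have hball := h z₀ hz₀ p hz₀p
      calc ∫⁻ z in D, k z p ∂μ ≤ ∫⁻ z, k z p ∂μ := setLIntegral_le_lintegral _ _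
        _ ≤ ∫⁻ z, (Metric.closedBall p β).indicator
              (fun _ => ENNReal.ofReal (Real.exp (|s| * β - s * ‖p‖))) z ∂μ := by
            refine lintegral_mono fun z => ?_
            by_cases hz : dist z p ≤ β
            · simp only [k, indicator, Metric.mem_closedBall, mem_ofPred_eq, hz, if_true, w]
              refine ENNReal.ofReal_le_ofReal (Real.exp_le_exp.2 ?_)
              have h3 : |s * ‖p‖ - s * ‖z‖| ≤ |s| * β := by
                rw [← mul_sub, abs_mul]
                refine mul_le_mul_of_nonneg_left ?_ (abs_nonneg s)
                rw [dist_comm, dist_eq_norm] at hz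
                exact (abs_norm_sub_norm_le p z).trans hz
              have := (abs_le.1 h3).2
              linarith
            · simp [k, indicator, hz]
        _ = ENNReal.ofReal (Real.exp (|s| * β - s * ‖p‖)) *
              ENNReal.ofReal (μ.real (Metric.closedBall p β)) := by
            rw [lintegral_indicator_const Metric.isClosed_closedBall.measurableSet,
              ofReal_measureReal (isCompact_closedBall p β).measure_lt_top.ne]
        _ ≤ _ := by
            rw [← ENNReal.ofReal_mul (by positivity), ← ENNReal.ofReal_mul (by positivity)]
            refine ENNReal.ofReal_le_ofReal ((mul_le_mul_of_nonneg_left hball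
              (Real.exp_pos _).le).trans (le_of_eq ?_))
            rw [show |s| * β - s * ‖p‖ = |s| * β + -((s - b) * ‖p‖) - b * ‖p‖ by ring,
              Real.exp_sub, Real.exp_add]
            field_simp
    · push Not at hne
      rw [setLIntegral_congr_fun (g := fun _ => 0) hD]
      · simp
      · intro z hz
        simp [k, indicator, (hne z hz).not_ge]
  have h3 : (∫⁻ z in D, w z ∂μ) * v < ⊤ := by
    rw [← lintegral_mul_const' _ _ hvt]
    simp_rw [← h1]
    rw [lintegral_lintegral_swap hk.aemeasurable]
    refine (lintegral_mono h2).trans_lt ?_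
    rw [lintegral_const_mul' _ _ ENNReal.ofReal_ne_top]
    exact ENNReal.mul_lt_top ENNReal.ofReal_lt_top
      (lintegral_exp_neg_mul_norm_lt_top ν (sub_pos.2 hbs))
  exact (ENNReal.mul_lt_top_iff.1 h3).elim (fun h => h.1) fun h => h.elim
    (fun h => h.trans_lt ENNReal.zero_lt_top) fun h => absurd h hv0

/-- Below the indicator of growth in a direction `x`, there are balls of large mass around points
close to large multiples of `x`. -/
theorem exists_large_closedBall {μ : Measure E} [IsFiniteMeasureOnCompacts μ] {x : E} (hx : x ≠ 0)
    {a : ℝ} (ha : (a : EReal) < growthIndicator μ x) {α β κ ε : ℝ} (hα : 0 < α) (hβ : 0 < β)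
    (hκ : 0 < κ) (hε : 0 < ε) :
    ∃ t : ℕ, 0 < t ∧ ∃ p, ‖p - (t : ℝ) • x‖ + α ≤ t * ε ∧
      Real.exp (t * a) ≤ κ * μ.real (Metric.closedBall p β) := by
  by_contra hcon
  push Not at hcon
  have : ProperSpace E := FiniteDimensional.proper_real E
  obtain ⟨a', haa', ha'⟩ := EReal.lt_iff_exists_real_btwn.1 ha
  have haa' := EReal.coe_lt_coe_iff.1 haa'
  set l := ‖x‖ with hl
  have hl0 : 0 < l := norm_pos_iff.2 hx
  refine ha'.not_ge ?_
  -- Directions within ε/2 of x. If all the balls in question were light, the weight with exponent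
  -- a' / l would be integrable on this cone, giving ψ(x) ≤ a'.
  have hC : IsOpenCone {z : E | ‖l • z - ‖z‖ • x‖ < ε / 2 * ‖z‖} :=
    isOpenCone_setOf_lt ⟨by fun_prop, fun t ht z => by
      rw [norm_smul, Real.norm_of_nonneg ht.le, mul_smul, smul_comm _ t, ← smul_sub, norm_smul,
          Real.norm_of_nonneg ht.le]⟩ (IsPosHomogeneous.norm.const_mul _)
  set C := {z : E | ‖l • z - ‖z‖ • x‖ < ε / 2 * ‖z‖} with hCdef
  have hxC : x ∈ C := by
    simp only [hCdef, mem_ofPred_eq, hl, sub_self, norm_zero]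
    positivity
  have hgoal : ∫⁻ z in C, ENNReal.ofReal (Real.exp (-(a' / l * ‖z‖))) ∂μ < ⊤ := by
    -- Beyond height T, the errors β (centre), l (rounding to an integer) and α use at most half of
    -- the allowed displacement; the extra 2 pays for replacing τ by its floor and keeps t positive.
    set T := 2 * (β + l + α) / ε + 2 with hT
    set R := l * T with hR
    have hT0 : 2 ≤ T := by rw [hT]; have : 0 ≤ 2 * (β + l + α) / ε := by positivity
                           linarith
    set K := Real.exp (|a| + |a / l| * β) / κ with hK
    rw [← inter_union_compl C (Metric.closedBall 0 R)]
    refine (lintegral_union_le _ _ _).trans_lt (ENNReal.add_lt_top.2 ⟨?_, ?_⟩)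
    · refine (lintegral_mono_set inter_subset_right).trans_lt ?_
      refine IntegrableOn.setLIntegral_lt_top ?_
      exact ContinuousOn.integrableOn_compact (isCompact_closedBall 0 R)
        (by fun_prop)
    · refine setLIntegral_exp_lt_top_of_closedBall_bound (b := a / l) (K := K)
        (hC.1.measurableSet.inter Metric.isClosed_closedBall.measurableSet.compl) hβ
        ((div_lt_div_iff_of_pos_right hl0).2 haa') (by positivity) fun z hz p hzp => ?_
      have hzC : ‖l • z - ‖z‖ • x‖ < ε / 2 * ‖z‖ := hz.1
      have hzR : R < ‖z‖ := by simpa using hz.2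
      set τ := ‖z‖ / l with hτ
      have hzτ : ‖z‖ = l * τ := by rw [hτ, mul_div_cancel₀ _ hl0.ne']
      have hτT : T < τ := by rw [hR, hzτ] at hzR; exact lt_of_mul_lt_mul_left hzR hl0.le
      have hτ0 : 0 ≤ τ := by linarith
      set t := ⌊τ⌋₊ with ht
      have ht1 : (t : ℝ) ≤ τ := Nat.floor_le hτ0
      have ht2 : τ < t + 1 := Nat.lt_floor_add_one τ
      have ht0 : 0 < t := by
        have : (0 : ℝ) < t := by linarith
        exact_mod_cast this
      have hzx : ‖z - τ • x‖ < ε / 2 * τ := by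
        have : l • z - ‖z‖ • x = l • (z - τ • x) := by rw [hzτ]; module
        rw [this, norm_smul, Real.norm_of_nonneg hl0.le, hzτ] at hzC
        refine lt_of_mul_lt_mul_left (a := l) ?_ hl0.le
        linarith
      have hp : ‖p - (t : ℝ) • x‖ + α ≤ t * ε := by
        have e : p - (t : ℝ) • x = (p - z) + (z - τ • x) + (τ - t) • x := by module
        have h1 : ‖p - z‖ ≤ β := by rwa [← dist_eq_norm, dist_comm]
        have h2 : ‖(τ - t) • x‖ ≤ l := by
          rw [norm_smul, Real.norm_of_nonneg (by linarith), ← hl]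
          exact mul_le_of_le_one_left hl0.le (by linarith)
        have h3 := norm_add₃_le (a := p - z) (b := z - τ • x) (c := (τ - t) • x)
        rw [← e] at h3
        have h4 : 2 * (β + l + α) = (T - 2) * ε := by rw [hT]; field_simp; ring
        have h5 : (T - 1) * ε ≤ t * ε := mul_le_mul_of_nonneg_right (by linarith) hε.le
        have h6 : τ * ε ≤ (t + 1) * ε := mul_le_mul_of_nonneg_right ht2.le hε.le
        linarith
      have hlt := hcon t ht0 p hp
      rw [hK, div_mul_eq_mul_div, le_div_iff₀ hκ, ← Real.exp_add, mul_comm _ κ]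
      refine hlt.le.trans (Real.exp_le_exp.2 ?_)
      have h1 : |t * a - τ * a| ≤ |a| := by
        rw [← sub_mul, abs_mul]
        refine mul_le_of_le_one_left (abs_nonneg a) (abs_le.2 ⟨by linarith, by linarith⟩)
      have h2 : |a / l * ‖z‖ - a / l * ‖p‖| ≤ |a / l| * β := by
        rw [← mul_sub, abs_mul]
        refine mul_le_mul_of_nonneg_left ?_ (abs_nonneg _)
        rw [dist_eq_norm] at hzp
        exact (abs_norm_sub_norm_le z p).trans hzp
      have h3 : a / l * ‖z‖ = τ * a := by rw [hzτ]; field_simp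
      have h4 := (abs_le.1 h1).2
      have h5 := (abs_le.1 h2).2
      linarith
  have := growthIndicator_le (IsPosHomogeneous.norm.const_mul (a' / l)) hC hgoal hxC
  rwa [← hl, div_mul_cancel₀ _ hl0.ne'] at this

end Haar

/-! ### Concave growth implies superadditivity -/

section Concave

variable {E : Type*} [NormedAddCommGroup E] [NormedSpace ℝ E]

/-- Summing n + 1 copies takes n additions, so the displacement is n * α; the spare α is why
`exists_large_closedBall` carries `+ α`. -/
theorem exists_large_near_nsmul {g : E → ℝ} (hg : ∀ x, 0 ≤ g x) {α : ℝ}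
    (h : ∀ x y, ∃ r, ‖r - (x + y)‖ ≤ α ∧ g x * g y ≤ g r) (p : E) (n : ℕ) :
    ∃ r, ‖r - ((n + 1 : ℕ) : ℝ) • p‖ ≤ n * α ∧ g p ^ (n + 1) ≤ g r := by
  induction n with
  | zero => exact ⟨p, by simp, by simp⟩
  | succ n ih =>
    obtain ⟨r, hr, hgr⟩ := ih
    obtain ⟨q, hq, hgq⟩ := h r p
    refine ⟨q, ?_, ?_⟩
    · have e : q - ((n + 1 + 1 : ℕ) : ℝ) • p = (q - (r + p)) + (r - ((n + 1 : ℕ) : ℝ) • p) := by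
        push_cast; module
      rw [e]
      refine (norm_add_le _ _).trans ((add_le_add hq hr).trans (le_of_eq ?_))
      push_cast
      ring
    · rw [pow_succ]
      exact (mul_le_mul_of_nonneg_right hgr (hg p)).trans hgq

variable [FiniteDimensional ℝ E] [MeasurableSpace E]

/-- Concave growth makes the mass of balls of a fixed radius supermultiplicative, up to a constant
and a bounded displacement of the centre. -/
theorem ConcaveGrowth.exists_supermultiplicative {μ : Measure E} [IsFiniteMeasureOnCompacts μ]
    (h : ConcaveGrowth μ) : ∃ α β κ : ℝ, 0 < α ∧ 0 < β ∧ 0 < κ ∧ ∀ x y, ∃ r, ‖r - (x + y)‖ ≤ α ∧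
      (κ * μ.real (Metric.closedBall x β)) * (κ * μ.real (Metric.closedBall y β)) ≤
        κ * μ.real (Metric.closedBall r β) := by
  have : ProperSpace E := FiniteDimensional.proper_real E
  obtain ⟨α, β, γ, hα, hβ, hγ, h⟩ := h
  have hfin : ∀ (x : E) r, μ (Metric.closedBall x r) ≠ ⊤ :=
    fun x r => (isCompact_closedBall x r).measure_lt_top.ne
  -- Cover the α-ball by finitely many β-balls: by pigeonhole one translate carries a 1 / `T.card`
  -- share of the mass, whence κ = γ / `T.card`.
  obtain ⟨T, hTsub, hTfin, hT⟩ := (isCompact_closedBall (0 : E) α).finite_cover_balls hβ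
  lift T to Finset E using hTfin
  have hTne : T.Nonempty := by
    have h0 : (0 : E) ∈ ⋃ x ∈ (T : Set E), Metric.ball x β :=
      hT (Metric.mem_closedBall_self hα.le)
    obtain ⟨x, hx, -⟩ := mem_iUnion₂.1 h0
    exact ⟨x, hx⟩
  have hcard : (0 : ℝ) < T.card := by exact_mod_cast hTne.card_pos
  refine ⟨α, β, γ / T.card, hα, hβ, by positivity, fun x y => ?_⟩
  have hcover : μ.real (Metric.closedBall (x + y) α) ≤
      ∑ i ∈ T, μ.real (Metric.closedBall (x + y + i) β) := by
    refine (measureReal_mono (fun z hz => ?_) ?_).trans (measureReal_biUnion_finset_le _ _)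
    · have hz' : z - (x + y) ∈ ⋃ i ∈ (T : Set E), Metric.ball i β :=
        hT (by simpa [dist_eq_norm] using hz)
      obtain ⟨i, hi, hiz⟩ := mem_iUnion₂.1 hz'
      refine mem_iUnion₂.2 ⟨i, hi, ?_⟩
      rw [Metric.mem_ball, dist_eq_norm] at hiz
      rw [Metric.mem_closedBall, dist_eq_norm, ← sub_sub]
      exact hiz.le
    · exact (T.isCompact_biUnion fun i _ => isCompact_closedBall _ _).measure_lt_top.ne
  have hxy : γ * μ.real (Metric.closedBall x β) * μ.real (Metric.closedBall y β) ≤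
      μ.real (Metric.closedBall (x + y) α) := by
    have := ENNReal.toReal_mono (hfin _ _) (h x y)
    rwa [ENNReal.toReal_mul, ENNReal.toReal_mul, ENNReal.toReal_ofReal hγ.le] at this
  obtain ⟨i, hi, hle⟩ : ∃ i ∈ T, γ * μ.real (Metric.closedBall x β) *
      μ.real (Metric.closedBall y β) / T.card ≤ μ.real (Metric.closedBall (x + y + i) β) := by
    refine Finset.exists_le_of_sum_le hTne ?_
    rw [Finset.sum_const, nsmul_eq_mul, mul_div_cancel₀ _ hcard.ne']
    exact hxy.trans hcover
  refine ⟨x + y + i, by simpa using hTsub hi, ?_⟩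
  refine le_trans (le_of_eq ?_) (mul_le_mul_of_nonneg_left hle (div_pos hγ hcard).le)
  ring

variable [BorelSpace E]

/-- Concave growth makes the indicator of growth superadditive. -/
theorem ConcaveGrowth.growthIndicator_add_le {μ : Measure E} [IsFiniteMeasureOnCompacts μ]
    (h : ConcaveGrowth μ) (hμ : SubexpDivergence μ) (x y : E) :
    growthIndicator μ x + growthIndicator μ y ≤ growthIndicator μ (x + y) := by
  by_cases hx : x = 0
  · simp [hx]
  by_cases hy : y = 0
  · simp [hy]
  obtain ⟨α, β, κ, hα, hβ, hκ, h⟩ := h.exists_supermultiplicative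
  refine EReal.add_le_of_forall_lt fun a' ha' b' hb' => ?_
  obtain ⟨a, haa', ha⟩ := EReal.lt_iff_exists_real_btwn.1 ha'
  obtain ⟨b, hbb', hb⟩ := EReal.lt_iff_exists_real_btwn.1 hb'
  refine (add_le_add haa'.le hbb'.le).trans ?_
  by_contra hcon
  rw [not_le, ← EReal.coe_add] at hcon
  obtain ⟨c, hc, hcab⟩ := EReal.lt_iff_exists_real_btwn.1 hcon
  have hcab := EReal.coe_lt_coe_iff.1 hcab
  obtain ⟨θ, hθ, ⟨L, hL, hLip⟩, hθc, hlt⟩ := exists_homogeneous_dominating hμ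
    (ContinuousLinearMap.id ℝ E) (y := x + y) (c := c) (fun z hz hz' => absurd hz' hz)
    (fun h0 => by rw [h0, growthIndicator_zero] at hc; exact EReal.coe_nonneg.1 hc.le)
    (fun z hz => by rwa [show z = x + y from hz])
  have hfin := lintegral_exp_neg_lt_top hθ hlt
  set I := ∫⁻ z, ENNReal.ofReal (Real.exp (-θ z)) ∂μ with hI
  set δ := a + b - c with hδ
  have hδ0 : 0 < δ := by rw [hδ]; linarith
  -- Chosen so that a displacement of 2ε per unit of T changes θ by at most half the gap δ.
  set ε := δ / (4 * (L + 1)) with hε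
  have hε0 : 0 < ε := by positivity
  have hLε : L * (2 * ε) ≤ δ / 2 := by
    have : (L + 1) * (2 * ε) = δ / 2 := by rw [hε]; field_simp; norm_num
    linarith
  obtain ⟨t, ht, p, hp, hpa⟩ := exists_large_closedBall hx ha hα hβ hκ hε0
  obtain ⟨u, hu, q, hq, hqb⟩ := exists_large_closedBall hy hb hα hβ hκ hε0
  set g : E → ℝ := fun z => κ * μ.real (Metric.closedBall z β) with hg
  have hg0 : ∀ z, 0 ≤ g z := fun z => by positivity
  have iter : ∀ {x p : E} {t : ℕ} {a : ℝ}, ‖p - (t : ℝ) • x‖ + α ≤ t * ε →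
      Real.exp (t * a) ≤ g p → ∀ j : ℕ, 0 < j → ∃ r, ‖r - ((j * t : ℕ) : ℝ) • x‖ + α ≤
        (j * t : ℕ) * ε ∧ Real.exp ((j * t : ℕ) * a) ≤ g r := by
    intro x p t a hp hpa j hj
    obtain ⟨n, rfl⟩ := Nat.exists_eq_succ_of_ne_zero hj.ne'
    obtain ⟨r, hr, hgr⟩ := exists_large_near_nsmul hg0 h p n
    refine ⟨r, ?_, ?_⟩
    · have e : r - (((n + 1) * t : ℕ) : ℝ) • x =
          (r - ((n + 1 : ℕ) : ℝ) • p) + ((n + 1 : ℕ) : ℝ) • (p - (t : ℝ) • x) := by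
        push_cast; module
      have h1 := norm_add_le (r - ((n + 1 : ℕ) : ℝ) • p) (((n + 1 : ℕ) : ℝ) • (p - (t : ℝ) • x))
      rw [← e, norm_smul, Real.norm_of_nonneg (Nat.cast_nonneg _)] at h1
      have h2 := mul_le_mul_of_nonneg_left hp (Nat.cast_nonneg (α := ℝ) (n + 1))
      push_cast at h1 h2 hr ⊢
      linarith
    · refine le_trans ?_ hgr
      rw [Nat.cast_mul, mul_assoc, Real.exp_nat_mul]
      exact pow_le_pow_left₀ (Real.exp_pos _).le hpa _
  -- With T = mut, a common multiple of t and u, a ball of mass at least e^{T(a+b)} / κ lies where θ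
  -- ≤ T(c + δ/2) + Lβ. It contributes a constant times e^{Tδ/2} to I, which is unbounded in m.
  have key : ∀ m : ℕ, 0 < m →
      Real.exp (-(L * β)) / κ * ((m * (u * t) : ℕ) * (δ / 2)) ≤ I.toReal := by
    intro m hm
    obtain ⟨r₁, hr₁, hg₁⟩ := iter hp hpa (m * u) (by positivity)
    obtain ⟨r₂, hr₂, hg₂⟩ := iter hq hqb (m * t) (by positivity)
    rw [show m * u * t = m * (u * t) by ring] at hr₁ hg₁
    rw [show m * t * u = m * (u * t) by ring] at hr₂ hg₂
    set T : ℝ := ((m * (u * t) : ℕ) : ℝ) with hT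
    have hT0 : 0 < T := by rw [hT]; positivity
    obtain ⟨r, hr, hgr⟩ := h r₁ r₂
    have hgr' : Real.exp (T * (a + b)) ≤ g r := by
      rw [mul_add, Real.exp_add]
      exact (mul_le_mul hg₁ hg₂ (Real.exp_pos _).le (hg0 _)).trans hgr
    have hrT : ‖r - T • (x + y)‖ ≤ T * (2 * ε) := by
      have e : r - T • (x + y) = (r - (r₁ + r₂)) + (r₁ - T • x) + (r₂ - T • y) := by module
      rw [e]
      refine norm_add₃_le.trans ?_
      linarith
    have hθr : θ r ≤ T * (c + δ / 2) := by
      have h1 := (abs_le.1 (hLip r (T • (x + y)))).2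
      have h2 := mul_le_mul_of_nonneg_left hrT hL
      have h3 := mul_le_mul_of_nonneg_left hLε hT0.le
      have h4 := mul_le_mul_of_nonneg_left hθc hT0.le
      rw [hθ.map_smul T hT0] at h1
      linarith
    have hball : Real.exp (-(L * β) - T * (c + δ / 2)) * μ.real (Metric.closedBall r β) ≤
        I.toReal := by
      rw [measureReal_def, ← ENNReal.toReal_ofReal (Real.exp_pos _).le, ← ENNReal.toReal_mul]
      refine ENNReal.toReal_mono hfin.ne ?_
      rw [← setLIntegral_const]
      refine (setLIntegral_mono' Metric.isClosed_closedBall.measurableSet fun z hz => ?_).trans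
        (setLIntegral_le_lintegral (Metric.closedBall r β) _)
      refine ENNReal.ofReal_le_ofReal (Real.exp_le_exp.2 ?_)
      have h1 := (abs_le.1 (hLip z r)).2
      have h2 : L * ‖z - r‖ ≤ L * β :=
        mul_le_mul_of_nonneg_left (by simpa [dist_eq_norm] using hz) hL
      linarith
    refine le_trans ?_ hball
    have h1 : Real.exp (T * (a + b)) / κ ≤ μ.real (Metric.closedBall r β) := by
      rwa [div_le_iff₀ hκ, mul_comm _ κ]
    refine le_trans ?_ (mul_le_mul_of_nonneg_left h1 (Real.exp_pos _).le)
    have e : Real.exp (-(L * β) - T * (c + δ / 2)) * (Real.exp (T * (a + b)) / κ) =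
        Real.exp (-(L * β)) / κ * Real.exp (T * (δ / 2)) := by
      rw [← mul_div_assoc, ← Real.exp_add, div_mul_eq_mul_div, ← Real.exp_add, hδ]
      ring_nf
    rw [e]
    gcongr
    linarith [Real.add_one_le_exp (T * (δ / 2))]
  set A := Real.exp (-(L * β)) / κ * (δ / 2) with hA
  have hA0 : 0 < A := by positivity
  obtain ⟨m, hm⟩ := exists_nat_gt (I.toReal / A)
  rw [div_lt_iff₀ hA0] at hm
  have hm0 : 0 < m := by
    rcases Nat.eq_zero_or_pos m with rfl | h
    · simp only [Nat.cast_zero, zero_mul] at hm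
      exact absurd hm ENNReal.toReal_nonneg.not_gt
    · exact h
  have hut : (1 : ℝ) ≤ (u * t : ℕ) := by exact_mod_cast Nat.mul_pos hu ht
  have := key m hm0
  have h2 : (m : ℝ) * A ≤ Real.exp (-(L * β)) / κ * ((m * (u * t) : ℕ) * (δ / 2)) := by
    rw [Nat.cast_mul, show Real.exp (-(L * β)) / κ * ((m : ℝ) * (u * t : ℕ) * (δ / 2)) =
      (m * A) * (u * t : ℕ) by rw [hA]; ring]
    exact le_mul_of_one_le_right (by positivity) hut
  linarith

end Concave

/-! ### Dominating functionals and Laplace integrals -/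

section Functionals

variable {G : Type*} [NormedAddCommGroup G] [NormedSpace ℝ G]

theorem isClosed_dominatingFunctionals (ψ : G → EReal) : IsClosed (dominatingFunctionals ψ) := by
  have : dominatingFunctionals ψ = ⋂ x, {φ : G →L[ℝ] ℝ | ψ x ≤ (φ x : EReal)} := by
    ext φ; simp [dominatingFunctionals]
  rw [this]
  refine isClosed_iInter fun x => isClosed_le continuous_const ?_
  exact continuous_coe_real_ereal.comp (ContinuousLinearMap.apply ℝ ℝ x).continuous

theorem convex_dominatingFunctionals (ψ : G → EReal) : Convex ℝ (dominatingFunctionals ψ) := by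
  intro φ hφ χ hχ a b ha hb hab x
  have h : ∀ c : EReal, c ≤ φ x → c ≤ χ x → c ≤ ((a * φ x + b * χ x : ℝ) : EReal) := by
    intro c h1 h2
    refine (le_min h1 h2).trans ?_
    rw [← EReal.coe_strictMono.monotone.map_min, EReal.coe_le_coe_iff]
    have h3 := mul_le_mul_of_nonneg_left (min_le_left (φ x) (χ x)) ha
    have h4 := mul_le_mul_of_nonneg_left (min_le_right (φ x) (χ x)) hb
    calc min (φ x) (χ x) = a * min (φ x) (χ x) + b * min (φ x) (χ x) := by
          rw [← add_mul, hab, one_mul]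
      _ ≤ _ := add_le_add h3 h4
  simpa using h (ψ x) (hφ x) (hχ x)

/-- A superadditive homogeneous function below a multiple of the norm is dominated by a continuous
linear functional. -/
theorem dominatingFunctionals_nonempty {ψ : G → EReal} (h0 : ψ 0 = 0)
    (hsmul : ∀ t : ℝ, 0 < t → ∀ x, ψ (t • x) = t * ψ x) (hadd : ∀ x y, ψ x + ψ y ≤ ψ (x + y))
    {M : ℝ} (hM : 0 ≤ M) (hle : ∀ x, ψ x ≤ ((M * ‖x‖ : ℝ) : EReal)) :
    (dominatingFunctionals ψ).Nonempty := by
  set S : Set (G × ℝ) := {q | M * ‖q.1‖ < q.2} with hS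
  set H : Set (G × ℝ) := {q | (q.2 : EReal) ≤ ψ q.1} with hH
  have hSo : IsOpen S := isOpen_lt (by fun_prop) (by fun_prop)
  have hSc : Convex ℝ S := by
    intro q hq r hr a b ha hb hab
    have hq : M * ‖q.1‖ < q.2 := hq
    have hr : M * ‖r.1‖ < r.2 := hr
    change M * ‖a • q.1 + b • r.1‖ < a • q.2 + b • r.2
    have h1 := mul_le_mul_of_nonneg_left (norm_add_le (a • q.1) (b • r.1)) hM
    rw [norm_smul, norm_smul, Real.norm_of_nonneg ha, Real.norm_of_nonneg hb] at h1
    refine h1.trans_lt ?_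
    simp only [smul_eq_mul]
    rcases ha.eq_or_lt with rfl | ha'
    · obtain rfl : b = 1 := by linarith
      linarith
    · have h2 := mul_lt_mul_of_pos_left hq ha'
      have h3 := mul_le_mul_of_nonneg_left hr.le hb
      linarith
  have hsmulH : ∀ t : ℝ, 0 ≤ t → ∀ q ∈ H, t • q ∈ H := by
    intro t ht q hq
    rcases ht.eq_or_lt with rfl | ht
    · simp [hH, h0]
    · have hq : (q.2 : EReal) ≤ ψ q.1 := hq
      change ((t * q.2 : ℝ) : EReal) ≤ ψ (t • q.1)
      rw [hsmul t ht, EReal.coe_mul]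
      exact mul_le_mul_of_nonneg_left hq (EReal.coe_nonneg.2 ht.le)
  have hHc : Convex ℝ H := by
    intro q hq r hr a b ha hb _
    have h1 : ((a • q).2 : EReal) ≤ ψ (a • q).1 := hsmulH a ha q hq
    have h2 : ((b • r).2 : EReal) ≤ ψ (b • r).1 := hsmulH b hb r hr
    change (((a • q).2 + (b • r).2 : ℝ) : EReal) ≤ ψ ((a • q).1 + (b • r).1)
    rw [EReal.coe_add]
    exact (add_le_add h1 h2).trans (hadd _ _)
  have hdisj : Disjoint S H := by
    rw [Set.disjoint_left]
    intro q hq hq'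
    have hq' : (q.2 : EReal) ≤ ψ q.1 := hq'
    exact (EReal.coe_lt_coe_iff.2 hq).not_ge (hq'.trans (hle q.1))
  -- Separate the open cone above `M * ‖x‖` from the hypograph of ψ. Both are stable under positive
  -- scaling, which forces u = 0; as f is negative on the vertical axis, its kernel is the graph of
  -- the desired functional.
  obtain ⟨f, u, hfS, hfH⟩ := geometric_hahn_banach_open hSc hSo hHc hdisj
  have hu : u ≤ 0 := by
    simpa using hfH 0 (by simp [hH, h0])
  have hu0 : 0 ≤ u := by
    by_contra hu'
    rw [not_le] at hu'
    have h1 := hfS ((0 : G), 1) (by simp [hS])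
    have hf1 : f ((0 : G), (1 : ℝ)) < 0 := h1.trans hu'
    have h2 := hfS ((u / (2 * f ((0 : G), (1 : ℝ)))) • ((0 : G), (1 : ℝ)))
      (by simpa [hS] using div_pos_of_neg_of_neg hu' (by linarith))
    rw [map_smul, smul_eq_mul] at h2
    have : u / (2 * f ((0 : G), (1 : ℝ))) * f ((0 : G), (1 : ℝ)) = u / 2 := by
      rw [div_mul_eq_mul_div, mul_div_mul_right _ _ hf1.ne]
    linarith
  have hf1 : f ((0 : G), (1 : ℝ)) < 0 := (hfS ((0 : G), 1) (by simp [hS])).trans_le hu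
  set k := f ((0 : G), (1 : ℝ)) with hk
  refine ⟨(-k)⁻¹ • f.comp (ContinuousLinearMap.inl ℝ G ℝ), fun x => ?_⟩
  refine EReal.ge_of_forall_gt_iff_ge.1 fun c hc => ?_
  have h1 := hu0.trans (hfH (x, c) hc.le)
  have e : (x, c) = (x, (0 : ℝ)) + c • ((0 : G), (1 : ℝ)) := by simp
  rw [e, map_add, map_smul, smul_eq_mul, ← hk] at h1
  rw [EReal.coe_le_coe_iff]
  change c ≤ (-k)⁻¹ * f (x, 0)
  rw [le_inv_mul_iff₀ (by linarith)]
  linarith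

variable [MeasurableSpace G] [OpensMeasurableSpace G]

theorem mem_dominatingFunctionals_of_laplaceIntegral_lt_top {ν : Measure G} {φ : G →L[ℝ] ℝ}
    (h : laplaceIntegral ν φ < ⊤) : φ ∈ dominatingFunctionals (growthIndicator ν) := fun x =>
  growthIndicator_le (IsPosHomogeneous.of_clm φ) isOpenCone_univ
    (by rwa [Measure.restrict_univ]) (mem_univ x)

/-- Subtracting a small multiple of a functional norming x stays in the set, so the domination by φ
is strict at each x ≠ 0. -/
theorem laplaceIntegral_lt_top_of_mem_interior [FiniteDimensional ℝ G] {ν : Measure G}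
    [IsFiniteMeasureOnCompacts ν] {φ : G →L[ℝ] ℝ}
    (h : φ ∈ interior (dominatingFunctionals (growthIndicator ν))) : laplaceIntegral ν φ < ⊤ := by
  refine lintegral_exp_neg_lt_top (IsPosHomogeneous.of_clm φ) fun x hx => ?_
  obtain ⟨χ, -, hχ⟩ := exists_dual_vector ℝ x (norm_ne_zero_iff.2 hx)
  have hcont : Continuous fun ε : ℝ => φ - ε • χ := by fun_prop
  have hmem : ∀ᶠ ε : ℝ in 𝓝 0, φ - ε • χ ∈ dominatingFunctionals (growthIndicator ν) :=
    hcont.continuousAt.eventually (by simpa using mem_interior_iff_mem_nhds.1 h)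
  obtain ⟨ε, hε, hε0⟩ := ((hmem.filter_mono nhdsWithin_le_nhds).and
    (self_mem_nhdsWithin (s := Ioi (0 : ℝ)))).exists
  refine (hε x).trans_lt (EReal.coe_lt_coe_iff.2 ?_)
  have hx' : 0 < ‖x‖ := norm_pos_iff.2 hx
  have : χ x = ‖x‖ := by simpa using hχ
  simp only [_root_.sub_apply, _root_.smul_apply, smul_eq_mul, this]
  have := mul_pos (mem_Ioi.1 hε0) hx'
  linarith

end Functionals

/-! ### Pushforward along a linear map -/

section Pushforward

variable {E : Type*} [NormedAddCommGroup E] [NormedSpace ℝ E]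
  [MeasurableSpace E] [BorelSpace E] {G : Type*} [NormedAddCommGroup G] [NormedSpace ℝ G]
  [MeasurableSpace G] [BorelSpace G] {μ : Measure E} {p : E →L[ℝ] G}

/-- A cone around p x pulls back to a cone around x. On the kernel the value at 0 is 0 by
convention, so `hker` is needed there. -/
theorem growthIndicator_le_map (hker : ∀ x, x ≠ 0 → p x = 0 → growthIndicator μ x = ⊥) (x : E) :
    growthIndicator μ x ≤ growthIndicator (μ.map p) (p x) := by
  by_cases hpx : p x = 0
  · by_cases hx : x = 0
    · simp [hx]
    · rw [hker x hx hpx]; exact bot_le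
  refine EReal.le_of_forall_lt_iff_le.1 fun c hc => ?_
  obtain ⟨C, hC, hxC, s, hs, hfin⟩ := (growthIndicator_lt_iff hpx).1 hc
  have hC' : IsOpenCone (p ⁻¹' C) := ⟨hC.1.preimage p.continuous, fun t ht z hz => by
    rw [mem_preimage, map_smul]; exact hC.2 t ht _ hz⟩
  refine (growthIndicator_le ((IsPosHomogeneous.norm.const_mul s).comp_clm p) hC' ?_ hxC).trans
    (EReal.coe_le_coe_iff.2 hs.le)
  rwa [expIntegral, setLIntegral_map hC.1.measurableSet (by fun_prop) p.continuous.measurable]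
    at hfin

variable [FiniteDimensional ℝ E]

/-- Since θ vanishes at 0 and is L-Lipschitz, it is at most L times the norm, so L is an admissible
exponent. -/
theorem SubexpDivergence.map [IsFiniteMeasureOnCompacts μ] (hμ : SubexpDivergence μ)
    (hker : ∀ x, x ≠ 0 → p x = 0 → growthIndicator μ x = ⊥) : SubexpDivergence (μ.map p) := by
  obtain ⟨θ, hθ, ⟨L, -, hLip⟩, -, hlt⟩ := exists_homogeneous_dominating hμ p hker (y := 0) (c := 1)
    (fun _ => zero_le_one) (fun x hx => by
      by_cases h0 : x = 0
      · rw [h0, growthIndicator_zero]; exact EReal.coe_pos.2 one_pos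
      · rw [hker x h0 hx]; exact EReal.bot_lt_coe _)
  refine ⟨L, ?_⟩
  rw [expIntegral, lintegral_map (by fun_prop) p.continuous.measurable]
  refine lt_of_le_of_lt (lintegral_mono fun x => ENNReal.ofReal_le_ofReal
    (Real.exp_le_exp.2 (neg_le_neg ?_))) (lintegral_exp_neg_lt_top (hθ.comp_clm p) hlt)
  have := (abs_le.1 (hLip (p x) 0)).2
  rwa [hθ.map_zero, sub_zero, sub_zero] at this

theorem growthIndicator_map [IsFiniteMeasureOnCompacts μ] (hμ : SubexpDivergence μ)
    (hker : ∀ x, x ≠ 0 → p x = 0 → growthIndicator μ x = ⊥) (y : G) :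
    growthIndicator (μ.map p) y = sSup {t : EReal | ∃ x, p x = y ∧ t = growthIndicator μ x} := by
  refine le_antisymm (EReal.le_of_forall_lt_iff_le.1 fun c hc => ?_) (sSup_le ?_)
  · have hfib : ∀ x, p x = y → growthIndicator μ x < c := fun x hx =>
      lt_of_le_of_lt (le_sSup (by exact ⟨x, hx, rfl⟩)) hc
    obtain ⟨θ, hθ, -, hθc, hlt⟩ := exists_homogeneous_dominating hμ p hker (y := y) (c := c)
      (fun hy => by
        have := hfib 0 (by simp [hy])
        rw [growthIndicator_zero] at this
        exact EReal.coe_nonneg.1 this.le) hfib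
    refine (growthIndicator_le hθ isOpenCone_univ ?_ (mem_univ y)).trans
      (EReal.coe_le_coe_iff.2 hθc)
    have hm := hθ.continuous.measurable
    rw [Measure.restrict_univ, lintegral_map (by fun_prop) p.continuous.measurable]
    exact lintegral_exp_neg_lt_top (hθ.comp_clm p) hlt
  · rintro _ ⟨x, rfl, rfl⟩
    exact growthIndicator_le_map hker x

theorem ConcaveGrowth.growthIndicator_map_add_le [IsFiniteMeasureOnCompacts μ]
    (h : ConcaveGrowth μ) (hμ : SubexpDivergence μ)
    (hker : ∀ x, x ≠ 0 → p x = 0 → growthIndicator μ x = ⊥) (y z : G) :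
    growthIndicator (μ.map p) y + growthIndicator (μ.map p) z ≤
      growthIndicator (μ.map p) (y + z) := by
  refine EReal.add_le_of_forall_lt fun a ha b hb => ?_
  rw [growthIndicator_map hμ hker, lt_sSup_iff] at ha hb
  obtain ⟨_, ⟨x, rfl, rfl⟩, ha⟩ := ha
  obtain ⟨_, ⟨w, rfl, rfl⟩, hb⟩ := hb
  rw [← map_add]
  exact (add_le_add ha.le hb.le).trans
    ((h.growthIndicator_add_le hμ x w).trans (growthIndicator_le_map hker (x + w)))

theorem ConcaveGrowth.isConcaveEReal_growthIndicator_map [IsFiniteMeasureOnCompacts μ]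
    (h : ConcaveGrowth μ) (hμ : SubexpDivergence μ)
    (hker : ∀ x, x ≠ 0 → p x = 0 → growthIndicator μ x = ⊥) :
    IsConcaveEReal (growthIndicator (μ.map p)) := by
  refine ⟨(hμ.map hker).growthIndicator_ne_top, fun x y a b ha hb _ => ?_⟩
  have := h.growthIndicator_map_add_le hμ hker (a • x) (b • y)
  rwa [growthIndicator_smul _ ha, growthIndicator_smul _ hb] at this

theorem ConcaveGrowth.dominatingFunctionals_map_nonempty [IsFiniteMeasureOnCompacts μ]
    (h : ConcaveGrowth μ) (hμ : SubexpDivergence μ)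
    (hker : ∀ x, x ≠ 0 → p x = 0 → growthIndicator μ x = ⊥) :
    (dominatingFunctionals (growthIndicator (μ.map p))).Nonempty := by
  obtain ⟨M, hM, hle⟩ := (hμ.map hker).exists_growthIndicator_le
  exact dominatingFunctionals_nonempty (growthIndicator_zero _)
    (fun t ht x => growthIndicator_smul _ ht x) (h.growthIndicator_map_add_le hμ hker) hM hle

end Pushforward

/-! ### The quotient map -/

theorem mainTheorem9 {E : Type*} [NormedAddCommGroup E] [NormedSpace ℝ E] [FiniteDimensional ℝ E]
    [MeasurableSpace E] [BorelSpace E] (F : Submodule ℝ E)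
    [MeasurableSpace (E ⧸ F)] [BorelSpace (E ⧸ F)]
    (μ : Measure E) [IsFiniteMeasureOnCompacts μ]
    (hμ : SubexpDivergence μ)
    (hF : ∀ x ∈ F, x ≠ 0 → growthIndicator μ x = ⊥) :
    (IsFiniteMeasureOnCompacts (μ.map F.mkQ) ∧
      SubexpDivergence (μ.map F.mkQ) ∧
      ∀ y : E ⧸ F,
        growthIndicator (μ.map F.mkQ) y = sSup {t : EReal | ∃ x : E, F.mkQ x = y ∧ t = growthIndicator μ x}) ∧
    (ConcaveGrowth μ →
      IsConcaveEReal (growthIndicator (μ.map F.mkQ)) ∧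
      (dominatingFunctionals (growthIndicator (μ.map F.mkQ))).Nonempty ∧
      IsClosed (dominatingFunctionals (growthIndicator (μ.map F.mkQ))) ∧
      Convex ℝ (dominatingFunctionals (growthIndicator (μ.map F.mkQ))) ∧
      ∀ φ : (E ⧸ F) →L[ℝ] ℝ,
        (laplaceIntegral (μ.map F.mkQ) φ < ⊤ →
          φ ∈ dominatingFunctionals (growthIndicator (μ.map F.mkQ))) ∧
        (φ ∈ interior (dominatingFunctionals (growthIndicator (μ.map F.mkQ))) →
          laplaceIntegral (μ.map F.mkQ) φ < ⊤)) := by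
  -- Closedness of F makes the quotient seminorm a norm, as the general results require.
  have : IsClosed (F : Set E) := F.closed_of_finiteDimensional
  have hker : ∀ x, x ≠ 0 → F.mkQL x = 0 → growthIndicator μ x = ⊥ := fun x hx hx' =>
    hF x ((Submodule.Quotient.mk_eq_zero F).1 hx') hx
  have hν : SubexpDivergence (μ.map F.mkQL) := hμ.map hker
  have hfin : IsFiniteMeasureOnCompacts (μ.map F.mkQL) := hν.isFiniteMeasureOnCompacts
  rw [← Submodule.coe_mkQL]
  refine ⟨⟨hfin, hν, growthIndicator_map hμ hker⟩, fun hc => ⟨?_, ?_, ?_, ?_, fun φ => ⟨?_, ?_⟩⟩⟩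
  · exact hc.isConcaveEReal_growthIndicator_map hμ hker
  · exact hc.dominatingFunctionals_map_nonempty hμ hker
  · exact isClosed_dominatingFunctionals _
  · exact convex_dominatingFunctionals _
  · exact mem_dominatingFunctionals_of_laplaceIntegral_lt_top
  · exact laplaceIntegral_lt_top_of_mem_interior
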